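/- Let $(X,d)$ be a pseudometric space equipped with a $\sigma$-algebra that contains all open balls (for instance the $\sigma$-algebra generated by the open balls, or the Borel $\sigma$-algebra generated by the open sets; the two coincide when $X$ is separable). A function $f\colon X\to[0,1]$ is nonexpansive if $|f(x)-f(y)|\le d(x,y)$ for all $x,y\in X$. For probability measures $\mu,\nu$ on $X$ put $$d_K(d)(\mu,\nu)=\sup\Big\{\Big|\int_X f\,d\nu-\int_X f\,d\mu\Big| \;:\; f\colon X\to[0,1]\text{ nonexpansive}\Big\},$$ and for nonempty sets $A,B$ of probability measures on $X$ put $$d_H(d_K(d))(A,B)=\max\Big(\sup_{\mu\in A}\inf_{\nu\in B} d_K(d)(\mu,\nu),\ \sup_{\nu\in B}\inf_{\mu\in A} d_K(d)(\mu,\nu)\Big).$$ Theorem. Let $A,B$ be nonempty convex sets of probability measures on $X$, each of which is concentrated on a separable subset of $X$ (this is automatic if $X$ is separable). Then every nonexpansive $f\colon X\to[0,1]$ is integrable with respect to (the completion of) every $\mu\in A\cup B$, and $$d_H(d_K(d))(A,B)=\sup\Big\{\Big|\sup_{\nu\in B}\int_X f\,d\nu-\sup_{\mu\in A}\int_X f\,d\mu\Big|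 \;:\; f\colon X\to[0,1]\text{ nonexpansive}\Big\}.$$ -/

import Mathlib

open MeasureTheory
open scoped NNReal

/-- The nonexpansive maps `f : (X, d) → ([0,1], d_e)`, viewed as real-valued functions. -/
def nonexpansiveUnitMaps (X : Type*) [PseudoMetricSpace X] : Set (X → ℝ) :=
  {f | (∀ x y, |f x - f y| ≤ dist x y) ∧ ∀ x, f x ∈ Set.Icc (0 : ℝ) 1}

/-- The Kantorovich distance of two probability measures:
the supremum of `|∫ f dν - ∫ f dμ|` over all nonexpansive `f : X → [0,1]`. -/
noncomputable def kantorovichDist {X : Type*} [PseudoMetricSpace X] [MeasurableSpace X]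
    (μ ν : ProbabilityMeasure X) : ℝ :=
  ⨆ f : nonexpansiveUnitMaps X,
    |(∫ x, f.1 x ∂(ν : Measure X)) - ∫ x, f.1 x ∂(μ : Measure X)|

/-- The Hausdorff distance of two sets with respect to a distance function `d`. It is used below
only for nonempty sets and for `d` with values in `[0,1]`, so that all suprema and infima exist. -/
noncomputable def hausdorffDistOf {M : Type*} (d : M → M → ℝ) (A B : Set M) : ℝ :=
  max (⨆ x : A, ⨅ y : B, d x.1 y.1) (⨆ y : B, ⨅ x : A, d x.1 y.1)

/-- A set of probability measures is convex if it is closed under the mixtures `a • μ + b • ν`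
with `a + b = 1`, computed in the `ℝ≥0`-module of all measures. -/
def IsConvexMeasureSet {X : Type*} [MeasurableSpace X] (A : Set (ProbabilityMeasure X)) : Prop :=
  Convex ℝ≥0 ((fun μ : ProbabilityMeasure X => (μ : Measure X)) '' A)

/-- The measure is concentrated on a separable set (automatic when `X` is separable, and
for discrete measures on any `X`). -/
def IsSeparablyConcentrated {X : Type*} [PseudoMetricSpace X] [MeasurableSpace X]
    (μ : ProbabilityMeasure X) : Prop :=
  ∃ S : Set X, TopologicalSpace.IsSeparable S ∧ (μ : Measure X) Sᶜ = 0

open Filter Topology Set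

/-! The right side is at most the left because sup `∫ f dν` over `B` exceeds sup `∫ f dμ` over `A`
by at most the one-sided Hausdorff excess. The converse is a minimax argument. Fix `ν ∈ B` and `c`
above the right side: each `f` has some `μ ∈ A` with `∫ f dν - ∫ f dμ < c`, and one `μ` must serve
all `f`. Nonexpansive maps into `[0,1]` form a convex set, compact for pointwise convergence;
separable concentration makes integrals continuous on it. Compactness leaves finitely many `μ`,
Hahn–Banach in finite dimension yields weights, and convexity of `A` turns the weighted mixture into
a member of `A`. -/

/-- One half of a minimax theorem: if a family of concave upper semicontinuous functions on a compact
convex set has, at every point, a member that is less than `c`, then some convex combination of the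
family is at most `c` everywhere. -/
theorem exists_convex_combination_le_of_forall_exists_lt {E ι : Type*} [AddCommGroup E] [Module ℝ E]
    [TopologicalSpace E] {F : Set E} (hF : IsCompact F) (hne : F.Nonempty) {φ : ι → E → ℝ}
    (hconc : ∀ i, ConcaveOn ℝ F (φ i)) (husc : ∀ i, UpperSemicontinuousOn (φ i) F) {c : ℝ}
    (h : ∀ f ∈ F, ∃ i, φ i f < c) :
    ∃ (t : Finset ι) (w : ι → ℝ), (∀ i ∈ t, 0 ≤ w i) ∧ ∑ i ∈ t, w i = 1 ∧
      ∀ f ∈ F, ∑ i ∈ t, w i * φ i f ≤ c := by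
  classical
  have hex : ∃ t : Finset ι, ∀ f ∈ F, ∃ i ∈ t, φ i f < c := by
    have : Nonempty ι := (h _ hne.some_mem).nonempty
    choose! i hi using h
    obtain ⟨s, -, hs⟩ := hF.elim_nhdsWithin_subcover (fun f => {g | φ (i f) g < c})
      (fun f hf => husc (i f) f hf c (hi f hf))
    refine ⟨s.image i, fun f hf => ?_⟩
    obtain ⟨g, hg, hfg⟩ := mem_iUnion₂.1 (hs hf)
    exact ⟨i g, Finset.mem_image_of_mem i hg, hfg⟩
  obtain ⟨t, ht⟩ := hex
  obtain ⟨f₀, hf₀⟩ := hne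
  have hFc : Convex ℝ F := by
    obtain ⟨i, -, -⟩ := ht f₀ hf₀
    exact (hconc i).1
  -- `K` is taken downward closed: this makes it convex for concave `φ i` and forces the sign of the
  -- separating functional.
  let U : Set (t → ℝ) := Set.univ.pi fun _ => Ioi c
  let K : Set (t → ℝ) := {x | ∃ f ∈ F, ∀ i : t, x i ≤ φ i f}
  have hU : Convex ℝ U := convex_pi fun _ _ => convex_Ioi c
  have hUo : IsOpen U := isOpen_set_pi finite_univ fun _ _ => isOpen_Ioi
  have hK : Convex ℝ K := by
    rintro x ⟨f, hf, hxf⟩ y ⟨g, hg, hyg⟩ a b ha hb hab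
    refine ⟨a • f + b • g, hFc hf hg ha hb hab, fun i => ?_⟩
    refine le_trans ?_ ((hconc i).2 hf hg ha hb hab)
    simp only [Pi.add_apply, Pi.smul_apply, smul_eq_mul]
    exact add_le_add (mul_le_mul_of_nonneg_left (hxf i) ha) (mul_le_mul_of_nonneg_left (hyg i) hb)
  have hdisj : Disjoint U K := by
    rw [Set.disjoint_left]
    rintro x hx ⟨f, hf, hxf⟩
    obtain ⟨i, hit, hi⟩ := ht f hf
    exact absurd (hx ⟨i, hit⟩ trivial) (not_lt.2 ((hxf ⟨i, hit⟩).trans hi.le))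
  obtain ⟨l, u, hlU, hlK⟩ := geometric_hahn_banach_open hU hUo hK hdisj
  let v : t → ℝ := fun i => -l (Pi.single i 1)
  have hl : ∀ x : t → ℝ, l x = -∑ i, v i * x i := by
    intro x
    conv_lhs => rw [pi_eq_sum_univ' x]
    simp [v, map_sum, mul_comm]
  have hv : ∀ i, 0 ≤ v i := by
    intro i
    by_contra hi
    push Not at hi
    let x₀ : t → ℝ := fun j => φ j f₀
    have hx : ∀ r : ℝ, 0 ≤ r → u ≤ l x₀ + r * v i := by
      intro r hr
      have hmem : x₀ - r • Pi.single i 1 ∈ K := by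
        refine ⟨f₀, hf₀, fun j => ?_⟩
        have : 0 ≤ r * (Pi.single i (1 : ℝ) : t → ℝ) j :=
          mul_nonneg hr (by by_cases hij : j = i <;> simp [hij])
        simpa [x₀] using this
      have := hlK _ hmem
      rw [map_sub, map_smul, smul_eq_mul] at this
      simp only [v]
      linarith
    have h0 := hx 0 le_rfl
    -- This `r` would push the value down to `u - 1`, below the separating level.
    have h1 := hx ((u - l x₀ - 1) / v i) (div_nonneg_of_nonpos (by linarith [hx 0 le_rfl]) hi.le)
    rw [div_mul_cancel₀ _ hi.ne] at h1
    linarith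
  have hbound : ∀ f ∈ F, ∀ e > c, ∑ i, v i * φ i f < e * ∑ i, v i := by
    intro f hf e he
    have h1 := hlU (fun _ => e) (fun _ _ => he)
    have h2 := hlK (fun i => φ i f) ⟨f, hf, fun _ => le_rfl⟩
    rw [hl] at h1 h2
    rw [← Finset.sum_mul, mul_comm] at h1
    linarith
  have hpos : 0 < ∑ i, v i := by
    refine (Finset.sum_nonneg fun i _ => hv i).lt_of_ne fun h0 => ?_
    have hv0 : ∀ i, v i = 0 := fun i =>
      (Finset.sum_eq_zero_iff_of_nonneg fun i _ => hv i).1 h0.symm i (Finset.mem_univ i)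
    simpa [hv0] using hbound f₀ hf₀ (c + 1) (by linarith)
  refine ⟨t, fun i => if hi : i ∈ t then v ⟨i, hi⟩ / ∑ j, v j else 0, fun i hi => ?_, ?_, ?_⟩
  · simpa [hi] using div_nonneg (hv _) hpos.le
  · rw [← Finset.sum_coe_sort t]
    simp only [Finset.coe_mem, dite_true, Subtype.coe_eta]
    rw [← Finset.sum_div, div_self hpos.ne']
  · intro f hf
    rw [← Finset.sum_coe_sort t]
    simp only [Finset.coe_mem, dite_true, Subtype.coe_eta, div_mul_eq_mul_div]
    rw [← Finset.sum_div, div_le_iff₀ hpos]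
    refine le_of_forall_gt_imp_ge_of_dense fun a ha => ?_
    have h3 := hbound f hf (a / ∑ i, v i) ((lt_div_iff₀ hpos).2 ha)
    rw [div_mul_cancel₀ _ hpos.ne'] at h3
    exact h3.le

/-! ### Mixtures of measures -/

/-- A set that is convex over `ℝ≥0` is closed under finite convex combinations. -/
theorem Convex.nnreal_sum_mem {M ι : Type*} [AddCommMonoid M] [Module ℝ≥0 M] {s : Set M}
    (hs : Convex ℝ≥0 s) {t : Finset ι} {w : ι → ℝ≥0} {z : ι → M} (hw : ∑ i ∈ t, w i = 1)
    (hz : ∀ i ∈ t, z i ∈ s) : ∑ i ∈ t, w i • z i ∈ s := by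
  classical
  -- Partial sums of weights are not 1, so the induction carries the total weight as a factor.
  have key : ∀ t : Finset ι, (∀ i ∈ t, z i ∈ s) → ∑ i ∈ t, w i ≠ 0 →
      ∃ y ∈ s, ∑ i ∈ t, w i • z i = (∑ i ∈ t, w i) • y := by
    intro t
    induction t using Finset.induction_on with
    | empty => simp
    | insert a t ha ih =>
      intro hz hne
      rw [Finset.sum_insert ha] at hne
      rw [Finset.sum_insert ha, Finset.sum_insert ha]
      by_cases ht : ∑ i ∈ t, w i = 0
      · refine ⟨z a, hz a (Finset.mem_insert_self a t), ?_⟩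
        rw [ht, add_zero, Finset.sum_eq_zero, add_zero]
        intro i hi
        rw [Finset.sum_eq_zero_iff.1 ht i hi, zero_smul]
      · obtain ⟨y, hy, hsum⟩ := ih (fun i hi => hz i (Finset.mem_insert_of_mem hi)) ht
        refine ⟨_, hs (hz a (Finset.mem_insert_self a t)) hy (a := w a / (w a + ∑ i ∈ t, w i))
          (b := (∑ i ∈ t, w i) / (w a + ∑ i ∈ t, w i)) zero_le zero_le ?_, ?_⟩
        · rw [← add_div, div_self hne]
        · rw [smul_add, smul_smul, smul_smul, mul_div_cancel₀ _ hne, mul_div_cancel₀ _ hne, hsum]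
  obtain ⟨y, hy, h⟩ := key t hz (by simp [hw])
  rw [h, hw, one_smul]
  exact hy

theorem IsConvexMeasureSet.exists_integral_eq_sum {X : Type*} [MeasurableSpace X]
    {A : Set (ProbabilityMeasure X)} (hA : IsConvexMeasureSet A) {t : Finset A} {w : A → ℝ} (hw : ∀ μ ∈ t, 0 ≤ w μ)
    (hw1 : ∑ μ ∈ t, w μ = 1) :
    ∃ μ₀ ∈ A, ∀ f : X → ℝ, (∀ μ ∈ A, Integrable f (μ : Measure X)) →
      ∫ x, f x ∂(μ₀ : Measure X) = ∑ μ ∈ t, w μ * ∫ x, f x ∂(μ.1 : Measure X) := by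
  have hsum : ∑ μ ∈ t, (w μ).toNNReal = 1 := by
    rw [← Real.toNNReal_sum_of_nonneg hw, hw1, Real.toNNReal_one]
  obtain ⟨μ₀, hμ₀, h⟩ := Convex.nnreal_sum_mem hA (w := fun μ => (w μ).toNNReal)
    (z := fun μ : A => (μ.1 : Measure X)) hsum (fun μ _ => mem_image_of_mem _ μ.2)
  refine ⟨μ₀, hμ₀, fun f hf => ?_⟩
  simp only at h
  rw [h, integral_finsetSum_measure fun μ _ => (hf μ.1 μ.2).smul_measure_nnreal]
  refine Finset.sum_congr rfl fun μ hμ => ?_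
  rw [integral_smul_nnreal_measure, NNReal.smul_def, Real.coe_toNNReal _ (hw μ hμ), smul_eq_mul]

/-! ### Nonexpansive functions and their integrals -/

section Nonexpansive

variable {X : Type*} [PseudoMetricSpace X]

theorem isCompact_nonexpansiveUnitMaps : IsCompact (nonexpansiveUnitMaps X) := by
  refine (isCompact_univ_pi fun _ : X => isCompact_Icc (a := (0 : ℝ)) (b := 1)).of_isClosed_subset
    ?_ fun f hf x _ => hf.2 x
  have h1 : IsClosed {f : X → ℝ | ∀ x y, |f x - f y| ≤ dist x y} := by
    simp only [ofPred_forall]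
    exact isClosed_iInter fun x => isClosed_iInter fun y =>
      isClosed_le (by fun_prop) continuous_const
  have h2 : IsClosed {f : X → ℝ | ∀ x, f x ∈ Icc (0 : ℝ) 1} := by
    simp only [ofPred_forall]
    exact isClosed_iInter fun x => isClosed_Icc.preimage (continuous_apply x)
  exact h1.inter h2

theorem convex_nonexpansiveUnitMaps : Convex ℝ (nonexpansiveUnitMaps X) := by
  intro f hf g hg a b ha hb hab
  refine ⟨fun x y => ?_, fun x => convex_Icc (0 : ℝ) 1 (hf.2 x) (hg.2 x) ha hb hab⟩
  have h : (a • f + b • g) x - (a • f + b • g) y = a * (f x - f y) + b * (g x - g y) := by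
    simp only [Pi.add_apply, Pi.smul_apply, smul_eq_mul]; ring
  rw [h]
  calc |a * (f x - f y) + b * (g x - g y)| ≤ a * |f x - f y| + b * |g x - g y| := by
        refine (abs_add_le _ _).trans ?_
        rw [abs_mul, abs_mul, abs_of_nonneg ha, abs_of_nonneg hb]
    _ ≤ a * dist x y + b * dist x y := by gcongr <;> [exact hf.1 x y; exact hg.1 x y]
    _ = dist x y := by rw [← add_mul, hab, one_mul]

theorem zero_mem_nonexpansiveUnitMaps : (0 : X → ℝ) ∈ nonexpansiveUnitMaps X := by
  simp [nonexpansiveUnitMaps]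

theorem one_sub_mem_nonexpansiveUnitMaps {f : X → ℝ} (hf : f ∈ nonexpansiveUnitMaps X) :
    (fun x => 1 - f x) ∈ nonexpansiveUnitMaps X := by
  refine ⟨fun x y => ?_, fun x => ?_⟩
  · have := hf.1 y x
    rw [dist_comm] at this
    simpa using this
  · have := hf.2 x
    constructor <;> linarith [this.1, this.2]

instance : Nonempty (nonexpansiveUnitMaps X) := ⟨⟨0, zero_mem_nonexpansiveUnitMaps⟩⟩

/-- For countable `D` this exhibits `f` on `closure D` as a countable infimum of functions
measurable as soon as balls are; `f` itself need not be measurable. -/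
theorem eq_iInf_add_dist_of_mem_closure {f : X → ℝ} (hf : f ∈ nonexpansiveUnitMaps X) {D : Set X}
    {x : X} (hx : x ∈ closure D) : f x = ⨅ d : D, (f d + dist x d) := by
  obtain ⟨d₀, hd₀⟩ := closure_nonempty_iff.1 ⟨x, hx⟩
  have : Nonempty D := ⟨⟨d₀, hd₀⟩⟩
  have hle : ∀ d : D, f x ≤ f d + dist x d := fun d => by
    linarith [le_abs_self (f x - f d), hf.1 x d]
  refine le_antisymm (le_ciInf hle) (le_of_forall_pos_lt_add fun ε hε => ?_)
  obtain ⟨d, hd, hxd⟩ := Metric.mem_closure_iff.1 hx (ε / 2) (half_pos hε)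
  refine (ciInf_le ⟨f x, forall_mem_range.2 hle⟩ ⟨d, hd⟩).trans_lt ?_
  have := hf.1 d x
  rw [dist_comm] at this
  simp only
  linarith [le_abs_self (f d - f x)]

variable [MeasurableSpace X]

theorem measurable_dist_right_of_measurableSet_ball
    (hball : ∀ (x : X) (r : ℝ), MeasurableSet (Metric.ball x r)) (y : X) :
    Measurable fun x => dist x y :=
  measurable_of_Iio fun r => hball y r

theorem IsSeparablyConcentrated.exists_countable {μ : ProbabilityMeasure X}
    (h : IsSeparablyConcentrated μ) :
    ∃ D : Set X, D.Countable ∧ ∀ᵐ x ∂(μ : Measure X), x ∈ closure D := by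
  obtain ⟨S, ⟨D, hD, hSD⟩, hS⟩ := h
  exact ⟨D, hD, measure_mono_null (fun x hx hxS => hx (hSD hxS)) hS⟩

theorem integrable_of_mem_nonexpansiveUnitMaps
    (hball : ∀ (x : X) (r : ℝ), MeasurableSet (Metric.ball x r)) {μ : ProbabilityMeasure X}
    (hμ : IsSeparablyConcentrated μ) {f : X → ℝ} (hf : f ∈ nonexpansiveUnitMaps X) :
    Integrable f (μ : Measure X) := by
  obtain ⟨D, hD, hμD⟩ := hμ.exists_countable
  have : Countable D := hD.to_subtype
  have hmeas : Measurable fun x : X => ⨅ d : D, (f d + dist x (d : X)) :=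
    Measurable.iInf fun d => (measurable_dist_right_of_measurableSet_ball hball _).const_add _
  refine Integrable.of_bound (C := 1) ⟨_, hmeas.stronglyMeasurable, ?_⟩ (.of_forall fun x => ?_)
  · exact hμD.mono fun x hx => eq_iInf_add_dist_of_mem_closure hf hx
  · rw [Real.norm_of_nonneg (hf.2 x).1]
    exact (hf.2 x).2

theorem integral_mem_Icc_of_mem_nonexpansiveUnitMaps (μ : ProbabilityMeasure X) {f : X → ℝ}
    (hf : f ∈ nonexpansiveUnitMaps X) : ∫ x, f x ∂(μ : Measure X) ∈ Icc (0 : ℝ) 1 := by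
  refine ⟨integral_nonneg fun x => (hf.2 x).1, (le_abs_self _).trans ?_⟩
  have := norm_integral_le_of_norm_le_const (μ := (μ : Measure X)) (f := f) (C := 1)
    (.of_forall fun x => by rw [Real.norm_of_nonneg (hf.2 x).1]; exact (hf.2 x).2)
  simpa using this

theorem continuousOn_integral_nonexpansiveUnitMaps
    (hball : ∀ (x : X) (r : ℝ), MeasurableSet (Metric.ball x r)) {μ : ProbabilityMeasure X}
    (hμ : IsSeparablyConcentrated μ) :
    ContinuousOn (fun f : X → ℝ => ∫ x, f x ∂(μ : Measure X)) (nonexpansiveUnitMaps X) := by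
  intro f₀ hf₀
  obtain ⟨D, hD, hμD⟩ := hμ.exists_countable
  have : Countable D := hD.to_subtype
  -- Dominated convergence needs a countably generated filter, which `𝓝 f₀` need not be. Convergence
  -- on the countable set `D` gives one, and equicontinuity extends it to `closure D`.
  let l : Filter (X → ℝ) := comap D.domRestrict (𝓝 (D.domRestrict f₀)) ⊓ 𝓟 (nonexpansiveUnitMaps X)
  have hl : 𝓝[nonexpansiveUnitMaps X] f₀ ≤ l := by
    refine inf_le_inf_right _ (Tendsto.le_comap ?_)
    exact (Continuous.tendsto (by unfold Set.domRestrict; fun_prop) f₀)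
  have hF : ∀ᶠ f in l, f ∈ nonexpansiveUnitMaps X := mem_inf_of_right (mem_principal_self _)
  refine Tendsto.mono_left ?_ hl
  refine tendsto_integral_filter_of_dominated_convergence (fun _ => 1)
    (hF.mono fun f hf => (integrable_of_mem_nonexpansiveUnitMaps hball hμ hf).aestronglyMeasurable)
    (hF.mono fun f hf => .of_forall fun x => ?_) (integrable_const _) (hμD.mono fun x hx => ?_)
  · rw [Real.norm_of_nonneg (hf.2 x).1]
    exact (hf.2 x).2
  · rw [Metric.tendsto_nhds]
    intro ε hε
    obtain ⟨d, hd, hxd⟩ := Metric.mem_closure_iff.1 hx (ε / 3) (by positivity)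
    have hdl : Tendsto (fun f : X → ℝ => f d) l (𝓝 (f₀ d)) :=
      (((continuous_apply (⟨d, hd⟩ : D)).tendsto (D.domRestrict f₀)).comp
        (tendsto_comap (f := (D.domRestrict : (X → ℝ) → D → ℝ)))).mono_left inf_le_left
    filter_upwards [hF, Metric.tendsto_nhds.1 hdl (ε / 3) (by positivity)] with f hf hfd
    have h1 := hf.1 x d
    have h2 := hf₀.1 d x
    rw [dist_comm] at h2
    rw [← Real.dist_eq] at h1 h2
    linarith [dist_triangle4 (f x) (f d) (f₀ d) (f₀ x)]

/-! ### Kantorovich distance and the minimax step -/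

theorem kantorovichDist_comm (μ ν : ProbabilityMeasure X) :
    kantorovichDist μ ν = kantorovichDist ν μ := by
  simp only [kantorovichDist, abs_sub_comm]

theorem abs_integral_sub_integral_le_one (μ ν : ProbabilityMeasure X) {f : X → ℝ}
    (hf : f ∈ nonexpansiveUnitMaps X) :
    |(∫ x, f x ∂(ν : Measure X)) - ∫ x, f x ∂(μ : Measure X)| ≤ 1 := by
  have h1 := integral_mem_Icc_of_mem_nonexpansiveUnitMaps μ hf
  have h2 := integral_mem_Icc_of_mem_nonexpansiveUnitMaps ν hf
  rw [abs_le]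
  constructor <;> linarith [h1.1, h1.2, h2.1, h2.2]

theorem abs_integral_sub_integral_le_kantorovichDist (μ ν : ProbabilityMeasure X) {f : X → ℝ}
    (hf : f ∈ nonexpansiveUnitMaps X) :
    |(∫ x, f x ∂(ν : Measure X)) - ∫ x, f x ∂(μ : Measure X)| ≤ kantorovichDist μ ν :=
  le_ciSup (f := fun f : nonexpansiveUnitMaps X =>
    |(∫ x, f.1 x ∂(ν : Measure X)) - ∫ x, f.1 x ∂(μ : Measure X)|)
    ⟨1, forall_mem_range.2 fun g => abs_integral_sub_integral_le_one μ ν g.2⟩ ⟨f, hf⟩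

theorem kantorovichDist_mem_Icc (μ ν : ProbabilityMeasure X) :
    kantorovichDist μ ν ∈ Icc (0 : ℝ) 1 :=
  ⟨Real.iSup_nonneg fun _ => abs_nonneg _,
    ciSup_le fun f => abs_integral_sub_integral_le_one μ ν f.2⟩

theorem bddAbove_range_integral (A : Set (ProbabilityMeasure X)) {f : X → ℝ}
    (hf : f ∈ nonexpansiveUnitMaps X) :
    BddAbove (range fun μ : A => ∫ x, f x ∂(μ.1 : Measure X)) :=
  ⟨1, forall_mem_range.2 fun μ => (integral_mem_Icc_of_mem_nonexpansiveUnitMaps μ.1 hf).2⟩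

theorem iSup_integral_mem_Icc (A : Set (ProbabilityMeasure X)) {f : X → ℝ}
    (hf : f ∈ nonexpansiveUnitMaps X) :
    ⨆ μ : A, ∫ x, f x ∂(μ.1 : Measure X) ∈ Icc (0 : ℝ) 1 :=
  ⟨Real.iSup_nonneg fun μ => (integral_mem_Icc_of_mem_nonexpansiveUnitMaps μ.1 hf).1,
    Real.iSup_le (fun μ => (integral_mem_Icc_of_mem_nonexpansiveUnitMaps μ.1 hf).2) zero_le_one⟩

theorem exists_kantorovichDist_le
    (hball : ∀ (x : X) (r : ℝ), MeasurableSet (Metric.ball x r))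
    {A : Set (ProbabilityMeasure X)} (hA : A.Nonempty) (hAconv : IsConvexMeasureSet A)
    (hAsep : ∀ μ ∈ A, IsSeparablyConcentrated μ) {ν : ProbabilityMeasure X}
    (hν : IsSeparablyConcentrated ν) {c : ℝ}
    (h : ∀ f ∈ nonexpansiveUnitMaps X,
      (∫ x, f x ∂(ν : Measure X)) - ⨆ μ : A, ∫ x, f x ∂(μ.1 : Measure X) < c) :
    ∃ μ ∈ A, kantorovichDist μ ν ≤ c := by
  have : Nonempty A := hA.to_subtype
  have hint : ∀ {μ : ProbabilityMeasure X}, IsSeparablyConcentrated μ → ∀ {f}, f ∈ nonexpansiveUnitMaps X →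
      Integrable f (μ : Measure X) :=
    fun {_} hμ {_} hf => integrable_of_mem_nonexpansiveUnitMaps hball hμ hf
  have hadd : ∀ {μ : ProbabilityMeasure X}, IsSeparablyConcentrated μ →
      ∀ {f}, f ∈ nonexpansiveUnitMaps X → ∀ {g}, g ∈ nonexpansiveUnitMaps X → ∀ a b : ℝ,
      ∫ x, (a • f + b • g) x ∂(μ : Measure X) =
        a * ∫ x, f x ∂(μ : Measure X) + b * ∫ x, g x ∂(μ : Measure X) := by
    intro μ hμ f hf g hg a b
    simp only [Pi.add_apply, Pi.smul_apply, smul_eq_mul]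
    rw [integral_add ((hint hμ hf).const_mul a) ((hint hμ hg).const_mul b),
      integral_const_mul, integral_const_mul]
  obtain ⟨t, w, hw, hw1, hle⟩ := exists_convex_combination_le_of_forall_exists_lt
    (isCompact_nonexpansiveUnitMaps (X := X)) ⟨0, zero_mem_nonexpansiveUnitMaps⟩ (c := c)
    (φ := fun (μ : A) f => (∫ x, f x ∂(ν : Measure X)) - ∫ x, f x ∂(μ.1 : Measure X))
    (fun μ => ⟨convex_nonexpansiveUnitMaps, fun f hf g hg a b _ _ _ => by
      simp only [hadd hν hf hg, hadd (hAsep μ μ.2) hf hg, smul_eq_mul]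
      exact (by ring : _ = _).le⟩)
    (fun μ => ((continuousOn_integral_nonexpansiveUnitMaps hball hν).sub
      (continuousOn_integral_nonexpansiveUnitMaps hball (hAsep μ μ.2))).upperSemicontinuousOn)
    (fun f hf => by
      obtain ⟨μ, hμ⟩ := exists_lt_of_lt_ciSup (sub_lt_comm.1 (h f hf))
      exact ⟨μ, sub_lt_comm.1 hμ⟩)
  obtain ⟨μ₀, hμ₀, hμ₀int⟩ := hAconv.exists_integral_eq_sum hw hw1
  have hone : ∀ f ∈ nonexpansiveUnitMaps X,
      (∫ x, f x ∂(ν : Measure X)) - ∫ x, f x ∂(μ₀ : Measure X) ≤ c := by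
    intro f hf
    refine le_trans (le_of_eq ?_) (hle f hf)
    rw [hμ₀int f fun μ hμ => hint (hAsep μ hμ) hf]
    simp only [mul_sub, Finset.sum_sub_distrib]
    rw [← Finset.sum_mul, hw1, one_mul]
  refine ⟨μ₀, hμ₀, ciSup_le fun ⟨f, hf⟩ => abs_le'.2 ⟨hone f hf, ?_⟩⟩
  -- Passing from `f` to `1 - f` flips the sign of the difference, so the one-sided bound gives the
  -- absolute value.
  have h1 := hone _ (one_sub_mem_nonexpansiveUnitMaps hf)
  rw [integral_sub (integrable_const _) (hint hν hf),
    integral_sub (integrable_const _) (hint (hAsep μ₀ hμ₀) hf)] at h1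
  simp only [integral_const, probReal_univ, smul_eq_mul, mul_one] at h1
  simp only
  linarith

theorem bddBelow_range_kantorovichDist {ι : Sort*} (μ ν : ι → ProbabilityMeasure X) :
    BddBelow (range fun i => kantorovichDist (μ i) (ν i)) :=
  ⟨0, forall_mem_range.2 fun i => (kantorovichDist_mem_Icc (μ i) (ν i)).1⟩

theorem bddAbove_range_iInf_kantorovichDist {ι κ : Type*} [Nonempty κ]
    (μ ν : ι → κ → ProbabilityMeasure X) :
    BddAbove (range fun i => ⨅ j, kantorovichDist (μ i j) (ν i j)) :=
  ⟨1, forall_mem_range.2 fun i =>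
    (ciInf_le (bddBelow_range_kantorovichDist (μ i) (ν i)) (Classical.arbitrary κ)).trans
      (kantorovichDist_mem_Icc _ _).2⟩

theorem iSup_integral_le_iSup_integral_add {A B : Set (ProbabilityMeasure X)} (hA : A.Nonempty)
    (hB : B.Nonempty) {f : X → ℝ} (hf : f ∈ nonexpansiveUnitMaps X) :
    ⨆ ν : B, ∫ x, f x ∂(ν.1 : Measure X) ≤
      (⨆ μ : A, ∫ x, f x ∂(μ.1 : Measure X)) + ⨆ ν : B, ⨅ μ : A, kantorovichDist μ.1 ν.1 := by
  have : Nonempty A := hA.to_subtype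
  have : Nonempty B := hB.to_subtype
  refine ciSup_le fun ν => le_of_forall_pos_lt_add fun ε hε => ?_
  obtain ⟨μ, hμ⟩ := exists_lt_of_ciInf_lt (lt_add_of_pos_right (⨅ μ : A, kantorovichDist μ.1 ν.1) hε)
  have h1 := le_ciSup (bddAbove_range_iInf_kantorovichDist
    (fun (_ : B) (μ : A) => μ.1) (fun (ν : B) (_ : A) => ν.1)) ν
  have h2 := le_ciSup (bddAbove_range_integral A hf) μ
  have h3 := (le_abs_self _).trans (abs_integral_sub_integral_le_kantorovichDist μ.1 ν.1 hf)
  linarith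

end Nonexpansive

theorem mainTheorem4 {X : Type*} [PseudoMetricSpace X] [MeasurableSpace X]
    (hball : ∀ (x : X) (r : ℝ), MeasurableSet (Metric.ball x r))
    (A B : Set (ProbabilityMeasure X))
    (hA : A.Nonempty) (hB : B.Nonempty)
    (hAconv : IsConvexMeasureSet A) (hBconv : IsConvexMeasureSet B)
    (hsep : ∀ μ ∈ A ∪ B, IsSeparablyConcentrated μ) :
    (∀ μ ∈ A ∪ B, ∀ f ∈ nonexpansiveUnitMaps X, Integrable f (μ : Measure X)) ∧
    hausdorffDistOf kantorovichDist A B =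
      ⨆ f : nonexpansiveUnitMaps X,
        |(⨆ ν : B, ∫ x, f.1 x ∂(ν.1 : Measure X)) -
          ⨆ μ : A, ∫ x, f.1 x ∂(μ.1 : Measure X)| := by
  have : Nonempty A := hA.to_subtype
  have : Nonempty B := hB.to_subtype
  have hAsep : ∀ μ ∈ A, IsSeparablyConcentrated μ := fun μ hμ => hsep μ (Or.inl hμ)
  have hBsep : ∀ ν ∈ B, IsSeparablyConcentrated ν := fun ν hν => hsep ν (Or.inr hν)
  refine ⟨fun μ hμ f hf => integrable_of_mem_nonexpansiveUnitMaps hball (hsep μ hμ) hf, ?_⟩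
  have hcomm : ∀ (μ : A) (ν : B), kantorovichDist μ.1 ν.1 = kantorovichDist ν.1 μ.1 :=
    fun μ ν => kantorovichDist_comm _ _
  apply le_antisymm
  · have hR : ∀ f ∈ nonexpansiveUnitMaps X,
        |(⨆ ν : B, ∫ x, f x ∂(ν.1 : Measure X)) - ⨆ μ : A, ∫ x, f x ∂(μ.1 : Measure X)| ≤
        ⨆ f : nonexpansiveUnitMaps X, |(⨆ ν : B, ∫ x, f.1 x ∂(ν.1 : Measure X)) -
          ⨆ μ : A, ∫ x, f.1 x ∂(μ.1 : Measure X)| := fun f hf =>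
      le_ciSup (f := fun f : nonexpansiveUnitMaps X =>
        |(⨆ ν : B, ∫ x, f.1 x ∂(ν.1 : Measure X)) - ⨆ μ : A, ∫ x, f.1 x ∂(μ.1 : Measure X)|)
        ⟨1, forall_mem_range.2 fun g => by
          have h1 := iSup_integral_mem_Icc A g.2
          have h2 := iSup_integral_mem_Icc B g.2
          exact abs_le.2 ⟨by linarith [h1.2, h2.1], by linarith [h1.1, h2.2]⟩⟩ ⟨f, hf⟩
    refine max_le (ciSup_le fun μ => ?_) (ciSup_le fun ν => ?_) <;>
      -- The slack `c` supplies the strict inequality that the compactness argument requires.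
      refine le_of_forall_gt_imp_ge_of_dense fun c hc => ?_
    · obtain ⟨ν, hν, hd⟩ := exists_kantorovichDist_le hball hB hBconv hBsep (hAsep μ μ.2) (c := c)
        fun f hf => by
          have h1 := (neg_le_abs _).trans (hR f hf)
          have h2 := le_ciSup (bddAbove_range_integral A hf) μ
          linarith
      rw [kantorovichDist_comm] at hd
      exact (ciInf_le (bddBelow_range_kantorovichDist (fun _ : B => μ.1) fun ν => ν.1)
        ⟨ν, hν⟩).trans hd
    · obtain ⟨μ, hμ, hd⟩ := exists_kantorovichDist_le hball hA hAconv hAsep (hBsep ν ν.2) (c := c)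
        fun f hf => by
          have h1 := (le_abs_self _).trans (hR f hf)
          have h2 := le_ciSup (bddAbove_range_integral B hf) ν
          linarith
      exact (ciInf_le (bddBelow_range_kantorovichDist (fun μ : A => μ.1) fun _ => ν.1)
        ⟨μ, hμ⟩).trans hd
  · refine ciSup_le fun ⟨f, hf⟩ => abs_le'.2 ⟨?_, ?_⟩
    · have h1 := iSup_integral_le_iSup_integral_add hA hB hf
      have h2 : _ ≤ hausdorffDistOf kantorovichDist A B := le_max_right _ _
      simp only
      linarith
    · have h1 := iSup_integral_le_iSup_integral_add hB hA hf
      have h2 : _ ≤ hausdorffDistOf kantorovichDist A B := le_max_left _ _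
      simp only [hcomm] at h2
      simp only
      linarith
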